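/- Let $H$ be a complex separable Hilbert space of dimension at least $2$ (for instance infinite-dimensional) and let $p$ be a real number with $1 \le p < \infty$, $p \ne 2$. Let $S_p$ be the Schatten class of compact operators $A$ on $H$ whose singular values $\sigma_i(A)$ (the square roots of the nonzero eigenvalues of $A^*A$, counted with multiplicity) satisfy $\sum_i \sigma_i(A)^p < \infty$, with the norm $\|A\|_{S_p} = \left(\sum_i \sigma_i(A)^p\right)^{1/p}$, and let $L_p = L_p((0,1),\mathbb{R})$ with Lebesgue measure. Then there exists a real linear subspace of $S_p$, of real dimension $3$, which with the $S_p$-norm is not linearly isometric to any (real linear) subspace of $L_p$. In fact, the space of real symmetric $2 \times 2$ matrices is an example: for every orthonormal pair $e_1, e_2$ in $H$, the real vector space of the operators $x \mapsto \sum_{i,j=1}^{2} M_{ij} \langle e_j, x\rangle e_i$, where $\langle\cdot,\cdot\rangle$ is linear in its second argument and $M$ runs over the real symmetric $2 \times 2$ matrices, is contained in $S_p$, has real dimension $3$, and with the $S_p$-norm is not linearly isometric to any subspace of $L_p$. -/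

import Mathlib

open MeasureTheory

noncomputable section

namespace Schatten

variable {H : Type*} [NormedAddCommGroup H] [InnerProductSpace ℂ H] [CompleteSpace H]

/-- The multiplicity of `s > 0` as a singular value of `A`: the dimension of the eigenspace of
`A* A` for the eigenvalue `s ^ 2`. For compact `A` and `s > 0` this eigenspace is
finite-dimensional. -/
def singularMultiplicity (A : H →L[ℂ] H) (s : ℝ) : ℕ :=
  Module.finrank ℂ (Module.End.eigenspace
    ((ContinuousLinearMap.adjoint A ∘L A : H →L[ℂ] H) : H →ₗ[ℂ] H) ((s ^ 2 : ℝ) : ℂ))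

/-- The sum `∑ σᵢ(A) ^ p` over the (nonzero) singular values of `A`, counted with multiplicity, as
an element of `[0, ∞]`. -/
def powerSum (p : ℝ) (A : H →L[ℂ] H) : ENNReal :=
  ∑' s : Set.Ioi (0 : ℝ), (singularMultiplicity A s : ENNReal) * ENNReal.ofReal ((s : ℝ) ^ p)

variable (H) in
/-- The Schatten class `S_p` on `H`: the compact operators whose singular values are
`p`-summable. -/
def schattenClass (p : ℝ) : Set (H →L[ℂ] H) :=
  {A | IsCompactOperator A ∧ powerSum p A < ⊤}

/-- The Schatten norm `(∑ σᵢ(A) ^ p) ^ (1 / p)`. -/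
def schattenNorm (p : ℝ) (A : H →L[ℂ] H) : ℝ :=
  (powerSum p A).toReal ^ (1 / p)

/-- The real Lebesgue space `L_p = L_p((0, 1), ℝ)`. -/
abbrev RealLp (p : ℝ) :=
  Lp ℝ (ENNReal.ofReal p) (volume.restrict (Set.Ioo (0 : ℝ) 1))

/-- The real vector space `V` of operators, with the Schatten `p`-norm, is linearly isometric to a
subspace of the real space `L_p`. -/
def IsometricToSubspaceOfLp (p : ℝ) (V : Submodule ℝ (H →L[ℂ] H)) : Prop :=
  ∃ (W : Submodule ℝ (RealLp p)) (T : V ≃ₗ[ℝ] W),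
    ∀ A : V, ‖(T A : RealLp p)‖ = schattenNorm p (A : H →L[ℂ] H)

/-- The operator `∑ i j, M i j • e i ⊗ (e j)*` on `H`. If `e` is orthonormal, it has matrix `M` with
respect to `e` on the span of `e`, and vanishes on the orthogonal complement of that span. -/
def ofMatrix (e : Fin 2 → H) (M : Matrix (Fin 2) (Fin 2) ℝ) : H →L[ℂ] H :=
  ∑ i, ∑ j, (M i j : ℝ) • InnerProductSpace.rankOne ℂ (e i) (e j)

/-- The real vector space of the operators on `H` given by real symmetric `2 × 2` matrices with
respect to `e`. -/
def symmetricMatrices (e : Fin 2 → H) : Submodule ℝ (H →L[ℂ] H) where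
  carrier := {A | ∃ M : Matrix (Fin 2) (Fin 2) ℝ, M.IsSymm ∧ A = ofMatrix e M}
  add_mem' := by
    rintro _ _ ⟨M, hM, rfl⟩ ⟨N, hN, rfl⟩
    exact ⟨M + N, hM.add hN, by simp [ofMatrix, add_smul]; abel⟩
  zero_mem' := ⟨0, Matrix.isSymm_zero, by simp [ofMatrix]⟩
  smul_mem' := by
    rintro c _ ⟨M, hM, rfl⟩
    exact ⟨c • M, hM.smul c, by simp [ofMatrix, mul_smul, smul_add]⟩

end Schatten

end

open scoped InnerProductSpace

namespace Schatten

/-! ### The equality case of Clarkson's inequality -/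

/-! For `s ^ 2 + t ^ 2 = 1` the reflection `R = !![s, t; t, -s]` gives complementary rank-one
projections `P = (1 + R) / 2` and `Q = (1 - R) / 2`. The `p`-th powers of the norms of `P`, `Q`, `P
+ Q = 1`, `P - Q = R` are 1, 1, 2, 2, so Clarkson's inequality is an equality for `P`, `Q`. In `L_p`
with `p ≠ 2` such equality forces disjoint supports (`ae_mul_eq_zero_of_clarkson_eq`). An isometric
embedding `F` thus satisfies `(F R) ^ 2 = (F 1) ^ 2` a.e. for every such `R`
(`ae_sq_eq_sq_of_isometry`). Applied to two reflections and to a combination of them that is again a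
reflection, this makes a product of two functions vanish although its square is `(F 1) ^ 4`. So `F 1
= 0`, contradicting the norm of the identity. -/

lemma rpow_add_rpow_lt_add_rpow {q x y : ℝ} (hq : 1 < q) (hx : 0 < x) (hy : 0 < y) :
    x ^ q + y ^ q < (x + y) ^ q := by
  have hsplit : ∀ z : ℝ, 0 < z → z ^ q = z * z ^ (q - 1) := fun z hz => by
    rw [Real.rpow_sub_one hz.ne']; field_simp
  rw [hsplit x hx, hsplit y hy, hsplit (x + y) (by positivity), add_mul]
  have h1 : x ^ (q - 1) < (x + y) ^ (q - 1) :=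
    Real.rpow_lt_rpow hx.le (by linarith) (by linarith)
  have h2 : y ^ (q - 1) < (x + y) ^ (q - 1) :=
    Real.rpow_lt_rpow hy.le (by linarith) (by linarith)
  gcongr

lemma add_rpow_lt_rpow_add_rpow {q x y : ℝ} (hq : q < 1) (hx : 0 < x) (hy : 0 < y) :
    (x + y) ^ q < x ^ q + y ^ q := by
  have hsplit : ∀ z : ℝ, 0 < z → z ^ q = z * z ^ (q - 1) := fun z hz => by
    rw [Real.rpow_sub_one hz.ne']; field_simp
  rw [hsplit x hx, hsplit y hy, hsplit (x + y) (by positivity), add_mul]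
  have h1 : (x + y) ^ (q - 1) < x ^ (q - 1) :=
    Real.rpow_lt_rpow_of_neg hx (by linarith) (by linarith)
  have h2 : (x + y) ^ (q - 1) < y ^ (q - 1) :=
    Real.rpow_lt_rpow_of_neg hy (by linarith) (by linarith)
  gcongr

lemma abs_rpow_eq_sq_rpow (p x : ℝ) : |x| ^ p = (x ^ 2) ^ (p / 2) := by
  rw [← sq_abs, ← Real.rpow_natCast_mul (abs_nonneg x)]
  congr 1
  push_cast
  ring

/-- Convexity of `t ^ (p / 2)` at `(a ± b) ^ 2`, whose midpoint is `a ^ 2 + b ^ 2`, is followed by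
superadditivity, which is strict unless `a` or `b` vanishes. For `p < 2` both steps reverse. -/
lemma clarkson_of_two_lt {p : ℝ} (hp : 2 < p) (a b : ℝ) :
    2 * (|a| ^ p + |b| ^ p) ≤ |a + b| ^ p + |a - b| ^ p ∧
      (|a + b| ^ p + |a - b| ^ p = 2 * (|a| ^ p + |b| ^ p) → a * b = 0) := by
  simp only [abs_rpow_eq_sq_rpow p]
  have hq : 1 < p / 2 := by linarith
  have hmid := (convexOn_rpow hq.le).2 (sq_nonneg (a + b)) (sq_nonneg (a - b))
    (by norm_num : (0 : ℝ) ≤ 1 / 2) (by norm_num : (0 : ℝ) ≤ 1 / 2) (by norm_num)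
  simp only [smul_eq_mul] at hmid
  rw [show 1 / 2 * (a + b) ^ 2 + 1 / 2 * (a - b) ^ 2 = a ^ 2 + b ^ 2 by ring] at hmid
  by_cases hab : a * b = 0
  · refine ⟨?_, fun _ => hab⟩
    have h0 : (0 : ℝ) ^ (p / 2) = 0 := Real.zero_rpow (by linarith)
    rcases mul_eq_zero.1 hab with rfl | rfl <;> simp [h0] <;> linarith
  · have ha : 0 < a ^ 2 := by have := left_ne_zero_of_mul hab; positivity
    have hb : 0 < b ^ 2 := by have := right_ne_zero_of_mul hab; positivity
    have := rpow_add_rpow_lt_add_rpow hq ha hb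
    exact ⟨by linarith, fun h => by linarith⟩

lemma clarkson_of_lt_two {p : ℝ} (hp : 0 < p) (hp2 : p < 2) (a b : ℝ) :
    |a + b| ^ p + |a - b| ^ p ≤ 2 * (|a| ^ p + |b| ^ p) ∧
      (|a + b| ^ p + |a - b| ^ p = 2 * (|a| ^ p + |b| ^ p) → a * b = 0) := by
  simp only [abs_rpow_eq_sq_rpow p]
  have hq : p / 2 < 1 := by linarith
  have hmid := (Real.concaveOn_rpow (by linarith) hq.le).2 (sq_nonneg (a + b)) (sq_nonneg (a - b))
    (by norm_num : (0 : ℝ) ≤ 1 / 2) (by norm_num : (0 : ℝ) ≤ 1 / 2) (by norm_num)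
  simp only [smul_eq_mul] at hmid
  rw [show 1 / 2 * (a + b) ^ 2 + 1 / 2 * (a - b) ^ 2 = a ^ 2 + b ^ 2 by ring] at hmid
  by_cases hab : a * b = 0
  · refine ⟨?_, fun _ => hab⟩
    have h0 : (0 : ℝ) ^ (p / 2) = 0 := Real.zero_rpow (by linarith)
    rcases mul_eq_zero.1 hab with rfl | rfl <;> simp [h0] <;> linarith
  · have ha : 0 < a ^ 2 := by have := left_ne_zero_of_mul hab; positivity
    have hb : 0 < b ^ 2 := by have := right_ne_zero_of_mul hab; positivity
    have := add_rpow_lt_rpow_add_rpow hq ha hb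
    exact ⟨by linarith, fun h => by linarith⟩

section Lp

variable {α : Type*} [MeasurableSpace α] {μ : Measure α} {p : ℝ}

lemma integrable_abs_rpow (hp : 0 < p) (f : Lp ℝ (ENNReal.ofReal p) μ) :
    Integrable (fun x => |f x| ^ p) μ := by
  simpa [ENNReal.toReal_ofReal hp.le] using
    (Lp.memLp f).integrable_norm_rpow (by simpa using hp) ENNReal.ofReal_ne_top

lemma norm_rpow_eq_integral (hp : 0 < p) (f : Lp ℝ (ENNReal.ofReal p) μ) :
    ‖f‖ ^ p = ∫ x, |f x| ^ p ∂μ := by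
  have hint : 0 ≤ ∫ x, |f x| ^ p ∂μ := integral_nonneg fun x => by positivity
  rw [Lp.norm_def, (Lp.memLp f).eLpNorm_eq_integral_rpow_norm (by simpa using hp)
    ENNReal.ofReal_ne_top, ENNReal.toReal_ofReal hp.le, ENNReal.toReal_ofReal (by positivity)]
  simp only [Real.norm_eq_abs]
  exact Real.rpow_inv_rpow hint hp.ne'

/-- Equality in Clarkson's inequality in `L_p`, `p ≠ 2`, forces disjoint supports. -/
lemma ae_mul_eq_zero_of_clarkson_eq (hp : 0 < p) (hp2 : p ≠ 2) (u v : Lp ℝ (ENNReal.ofReal p) μ)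
    (h : ‖u + v‖ ^ p + ‖u - v‖ ^ p = 2 * (‖u‖ ^ p + ‖v‖ ^ p)) :
    ∀ᵐ x ∂μ, u x * v x = 0 := by
  have hi := integrable_abs_rpow (μ := μ) hp
  have hR : Integrable (fun x => 2 * (|u x| ^ p + |v x| ^ p)) μ :=
    ((hi u).add (hi v)).const_mul 2
  have hL : Integrable (fun x => |(u + v) x| ^ p + |(u - v) x| ^ p) μ :=
    (hi (u + v)).add (hi (u - v))
  simp only [norm_rpow_eq_integral hp] at h
  rw [← integral_add (hi _) (hi _), ← integral_add (hi _) (hi _), ← integral_const_mul] at h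
  have hadd := Lp.coeFn_add u v
  have hsub := Lp.coeFn_sub u v
  -- On either side of 2 the pointwise inequality has a fixed direction, so equal integrals force
  -- equality a.e.
  rcases lt_or_gt_of_ne hp2 with hlt | hgt
  · have hle : (fun x => |(u + v) x| ^ p + |(u - v) x| ^ p) ≤ᵐ[μ]
        fun x => 2 * (|u x| ^ p + |v x| ^ p) := by
      filter_upwards [hadd, hsub] with x h1 h2
      rw [h1, h2]
      exact (clarkson_of_lt_two hp hlt _ _).1
    filter_upwards [(integral_eq_iff_of_ae_le hL hR hle).1 h, hadd, hsub] with x hx h1 h2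
    rw [h1, h2] at hx
    exact (clarkson_of_lt_two hp hlt _ _).2 hx
  · have hle : (fun x => 2 * (|u x| ^ p + |v x| ^ p)) ≤ᵐ[μ]
        fun x => |(u + v) x| ^ p + |(u - v) x| ^ p := by
      filter_upwards [hadd, hsub] with x h1 h2
      rw [h1, h2]
      exact (clarkson_of_two_lt hgt _ _).1
    filter_upwards [(integral_eq_iff_of_ae_le hR hL hle).1 h.symm, hadd, hsub] with x hx h1 h2
    rw [h1, h2] at hx
    exact (clarkson_of_two_lt hgt _ _).2 hx.symm

end Lp

variable {H : Type*} [NormedAddCommGroup H] [InnerProductSpace ℂ H]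

/-! ### Singular values of diagonal operators of finite rank -/

lemma isCompactOperator_rankOne (x y : H) :
    IsCompactOperator (InnerProductSpace.rankOne ℂ x y) := by
  have h : IsCompactOperator (innerSL ℂ y) :=
    ⟨Metric.closedBall 0 1, isCompact_closedBall 0 1,
      (innerSL ℂ y).continuous.continuousAt.preimage_mem_nhds
        (by simpa using Metric.closedBall_mem_nhds (0 : ℂ) one_pos)⟩
  exact h.clm_comp (ContinuousLinearMap.toSpanSingleton ℂ x)

/-- The operator with eigenvectors `f i` and real eigenvalues `d i`. -/
noncomputable def diagonalOp {ι : Type*} [Fintype ι] (f : ι → H) (d : ι → ℝ) : H →L[ℂ] H :=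
  ∑ i, d i • InnerProductSpace.rankOne ℂ (f i) (f i)

section

variable {ι : Type*} [Fintype ι] {f : ι → H}

lemma isCompactOperator_diagonalOp (f : ι → H) (d : ι → ℝ) :
    IsCompactOperator (diagonalOp f d) := by
  have h : diagonalOp f d ∈ compactOperator (RingHom.id ℂ) H H := by
    refine Submodule.sum_mem _ fun i _ => ?_
    rw [← Complex.coe_smul]
    exact Submodule.smul_mem _ _ (isCompactOperator_rankOne _ _)
  exact h

lemma diagonalOp_apply (d : ι → ℝ) (x : H) :
    diagonalOp f d x = ∑ i, ((d i : ℂ) * ⟪f i, x⟫_ℂ) • f i := by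
  simp [diagonalOp, mul_smul]

lemma inner_diagonalOp_apply (hf : Orthonormal ℂ f) (d : ι → ℝ) (i : ι) (x : H) :
    ⟪f i, diagonalOp f d x⟫_ℂ = d i * ⟪f i, x⟫_ℂ := by
  rw [diagonalOp_apply, hf.inner_right_fintype]

lemma adjoint_diagonalOp [CompleteSpace H] (d : ι → ℝ) :
    ContinuousLinearMap.adjoint (diagonalOp f d) = diagonalOp f d := by
  refine ((ContinuousLinearMap.eq_adjoint_iff _ _).2 fun x y => ?_).symm
  simp only [diagonalOp_apply, sum_inner, inner_sum, inner_smul_left, inner_smul_right, map_mul,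
    Complex.conj_ofReal, inner_conj_symm]
  exact Finset.sum_congr rfl fun i _ => by ring

lemma eigenspace_adjoint_comp_diagonalOp [CompleteSpace H] (hf : Orthonormal ℂ f) (d : ι → ℝ)
    {s : ℝ} (hs : 0 < s) :
    Module.End.eigenspace ((ContinuousLinearMap.adjoint (diagonalOp f d) ∘L diagonalOp f d :
      H →L[ℂ] H) : H →ₗ[ℂ] H) ((s ^ 2 : ℝ) : ℂ) =
      Submodule.span ℂ (Set.range fun i : {i // |d i| = s} => f i) := by
  have hs2 : ((s ^ 2 : ℝ) : ℂ) ≠ 0 := by exact_mod_cast (pow_pos hs 2).ne'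
  rw [adjoint_diagonalOp]
  apply le_antisymm
  · intro x hx
    rw [Module.End.mem_eigenspace_iff] at hx
    change diagonalOp f d (diagonalOp f d x) = _ at hx
    have hcoef : ∀ i, |d i| ≠ s → ⟪f i, x⟫_ℂ = 0 := by
      intro i hi
      have h := congrArg (fun y => ⟪f i, y⟫_ℂ) hx
      simp only [inner_diagonalOp_apply hf, inner_smul_right] at h
      by_contra hne
      rw [← mul_assoc] at h
      have h2 := mul_right_cancel₀ hne h
      have h3 : d i ^ 2 = s ^ 2 := by rw [sq]; exact_mod_cast h2
      exact hi (by rw [← abs_of_pos hs]; exact (sq_eq_sq_iff_abs_eq_abs _ _).1 h3)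
    -- As `s ^ 2 ≠ 0`, it suffices to place `s ^ 2 • x` in the span; it lies in the range of the
    -- operator, and its terms with `|d i| ≠ s` vanish.
    rw [← Submodule.smul_mem_iff _ hs2, ← hx, diagonalOp_apply]
    refine Submodule.sum_mem _ fun i _ => ?_
    by_cases hi : |d i| = s
    · exact Submodule.smul_mem _ _ (Submodule.subset_span ⟨⟨i, hi⟩, rfl⟩)
    · simp [inner_diagonalOp_apply hf, hcoef i hi]
  · rw [Submodule.span_le]
    rintro _ ⟨⟨i, hi⟩, rfl⟩
    have hfi : diagonalOp f d (f i) = (d i : ℂ) • f i := by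
      classical
      rw [diagonalOp_apply, Finset.sum_eq_single i]
      · simp [hf.1 i]
      · intro j _ hj
        simp [hf.2 hj]
      · simp
    rw [SetLike.mem_coe, Module.End.mem_eigenspace_iff]
    change diagonalOp f d (diagonalOp f d (f i)) = _
    rw [hfi, map_smul, hfi, smul_smul]
    congr 1
    rw [← hi, sq_abs, sq, Complex.ofReal_mul]

open Classical in
lemma singularMultiplicity_diagonalOp [CompleteSpace H] (hf : Orthonormal ℂ f) (d : ι → ℝ)
    {s : ℝ} (hs : 0 < s) :
    singularMultiplicity (diagonalOp f d) s = ∑ i, if |d i| = s then 1 else 0 := by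
  rw [singularMultiplicity, eigenspace_adjoint_comp_diagonalOp hf d hs,
    finrank_span_eq_card (b := fun i : {i // |d i| = s} => f i)
      (hf.linearIndependent.comp _ Subtype.val_injective), Fintype.card_subtype, Finset.card_filter]

lemma powerSum_diagonalOp [CompleteSpace H] (hf : Orthonormal ℂ f) (d : ι → ℝ) {p : ℝ}
    (hp : 0 < p) :
    powerSum p (diagonalOp f d) = ENNReal.ofReal (∑ i, |d i| ^ p) := by
  classical
  have hterm : ∀ s : Set.Ioi (0 : ℝ),
      (singularMultiplicity (diagonalOp f d) s : ENNReal) * ENNReal.ofReal ((s : ℝ) ^ p) =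
        ∑ i, if |d i| = s then ENNReal.ofReal (|d i| ^ p) else 0 := by
    intro s
    rw [singularMultiplicity_diagonalOp hf d s.2]
    push_cast
    rw [Finset.sum_mul]
    refine Finset.sum_congr rfl fun i _ => ?_
    split_ifs with h <;> simp [h]
  rw [powerSum, tsum_congr hterm, Summable.tsum_finsetSum fun _ _ => ENNReal.summable,
    ENNReal.ofReal_sum_of_nonneg fun i _ => by positivity]
  refine Finset.sum_congr rfl fun i _ => ?_
  by_cases hi : d i = 0
  · simp [hi, Real.zero_rpow hp.ne']
  · rw [tsum_eq_single (⟨|d i|, abs_pos.2 hi⟩ : Set.Ioi (0 : ℝ))]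
    · simp
    · intro s hs
      rw [if_neg]
      exact fun h => hs (Subtype.ext h.symm)

end

/-! ### Real symmetric `2 × 2` matrices -/

lemma exists_ofMatrix_eq_diagonalOp {e : Fin 2 → H} (he : Orthonormal ℂ e) (a b c : ℝ) :
    ∃ (f : Fin 2 → H) (d : Fin 2 → ℝ), Orthonormal ℂ f ∧ ofMatrix e !![a, b; b, c] = diagonalOp f d
      ∧ d 0 + d 1 = a + c ∧ d 0 * d 1 = a * c - b ^ 2 := by
  -- The modulus of `z` is the gap between the eigenvalues, and half its argument is the angle of
  -- the diagonalising rotation.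
  let z : ℂ := ⟨a - c, 2 * b⟩
  let r := ‖z‖
  let φ := z.arg / 2
  let C := Real.cos φ
  let S := Real.sin φ
  have hCS : C ^ 2 + S ^ 2 = 1 := Real.cos_sq_add_sin_sq φ
  have hre : r * (C ^ 2 - S ^ 2) = a - c := by
    rw [← Real.cos_two_mul', mul_div_cancel₀ _ (two_ne_zero' ℝ)]
    exact Complex.norm_mul_cos_arg z
  have him : r * (S * C) = b := by
    have h : r * Real.sin (2 * φ) = 2 * b := by
      rw [mul_div_cancel₀ _ (two_ne_zero' ℝ)]
      exact Complex.norm_mul_sin_arg z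
    rw [Real.sin_two_mul] at h
    linarith
  have hr : r ^ 2 = (a - c) ^ 2 + 4 * b ^ 2 := by
    rw [← hre, ← him]; linear_combination (-r ^ 2 * (C ^ 2 + S ^ 2 + 1)) * hCS
  have ha : a = (a + c + r) / 2 * C ^ 2 + (a + c - r) / 2 * S ^ 2 := by
    linear_combination (-1 / 2) * hre - (a + c) / 2 * hCS
  have hb : b = (a + c + r) / 2 * (C * S) - (a + c - r) / 2 * (C * S) := by
    linear_combination -him
  have hc : c = (a + c + r) / 2 * S ^ 2 + (a + c - r) / 2 * C ^ 2 := by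
    linear_combination (1 / 2) * hre - (a + c) / 2 * hCS
  have hCSc : (C : ℂ) * C + S * S = 1 := by rw [← sq, ← sq]; exact_mod_cast hCS
  have he' := orthonormal_iff_ite.1 he
  refine ⟨![(C : ℂ) • e 0 + (S : ℂ) • e 1, -(S : ℂ) • e 0 + (C : ℂ) • e 1],
    ![(a + c + r) / 2, (a + c - r) / 2], ?_, ?_, ?_, ?_⟩
  · rw [orthonormal_iff_ite]
    intro i j
    fin_cases i <;> fin_cases j <;>
      simp [inner_add_left, inner_add_right, inner_smul_left, inner_smul_right, he',
        -inner_self_eq_norm_sq_to_K, -Complex.coe_smul] <;>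
      first | linear_combination hCSc | ring
  · ext x
    have ha' := congrArg (Complex.ofReal) ha
    have hb' := congrArg (Complex.ofReal) hb
    have hc' := congrArg (Complex.ofReal) hc
    push_cast at ha' hb' hc'
    rw [diagonalOp_apply]
    simp only [ofMatrix, Fin.sum_univ_two, Matrix.of_apply, Matrix.cons_val', Matrix.cons_val_zero,
      Matrix.cons_val_one, Matrix.cons_val_fin_one, _root_.add_apply,
      _root_.smul_apply, InnerProductSpace.rankOne_apply, inner_add_left,
      inner_smul_left, ← Complex.coe_smul, Complex.conj_ofReal, map_neg]
    push_cast
    match_scalars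
    · linear_combination ⟪e 0, x⟫_ℂ * ha' + ⟪e 1, x⟫_ℂ * hb'
    · linear_combination ⟪e 0, x⟫_ℂ * hb' + ⟪e 1, x⟫_ℂ * hc'
  · simp; ring
  · simp; linear_combination (-1 / 4) * hr

lemma powerSum_ofMatrix [CompleteSpace H] {e : Fin 2 → H} (he : Orthonormal ℂ e) {p : ℝ}
    (hp : 0 < p) {a b c x y : ℝ} (hadd : x + y = a + c) (hmul : x * y = a * c - b ^ 2) :
    powerSum p (ofMatrix e !![a, b; b, c]) = ENNReal.ofReal (|x| ^ p + |y| ^ p) := by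
  obtain ⟨f, d, hf, hfd, h1, h2⟩ := exists_ofMatrix_eq_diagonalOp he a b c
  rw [hfd, powerSum_diagonalOp hf d hp, Fin.sum_univ_two]
  -- Trace and determinant fix the eigenvalues up to order: `d 0` is a root of `(T - x) * (T - y)`.
  have h : (d 0 - x) * (d 0 - y) = 0 := by
    linear_combination d 0 * h1 - h2 - d 0 * hadd + hmul
  rcases mul_eq_zero.1 h with h | h
  · rw [show d 0 = x by linarith, show d 1 = y by linarith]
  · rw [show d 0 = y by linarith, show d 1 = x by linarith, add_comm]

lemma schattenNorm_ofMatrix_rpow [CompleteSpace H] {e : Fin 2 → H} (he : Orthonormal ℂ e) {p : ℝ}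
    (hp : 0 < p) {a b c x y : ℝ} (hadd : x + y = a + c) (hmul : x * y = a * c - b ^ 2) :
    schattenNorm p (ofMatrix e !![a, b; b, c]) ^ p = |x| ^ p + |y| ^ p := by
  rw [schattenNorm, powerSum_ofMatrix he hp hadd hmul, ENNReal.toReal_ofReal (by positivity),
    one_div, Real.rpow_inv_rpow (by positivity) hp.ne']

lemma mem_symmetricMatrices_iff {e : Fin 2 → H} {A : H →L[ℂ] H} :
    A ∈ symmetricMatrices e ↔ ∃ a b c : ℝ, A = ofMatrix e !![a, b; b, c] := by
  constructor
  · rintro ⟨M, hM, rfl⟩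
    refine ⟨M 0 0, M 0 1, M 1 1, ?_⟩
    congr 1
    ext i j
    fin_cases i <;> fin_cases j <;> simp [hM.apply]
  · rintro ⟨a, b, c, rfl⟩
    refine ⟨_, ?_, rfl⟩
    ext i j
    fin_cases i <;> fin_cases j <;> rfl

lemma symmetricMatrices_subset_schattenClass [CompleteSpace H] {e : Fin 2 → H}
    (he : Orthonormal ℂ e) {p : ℝ} (hp : 0 < p) :
    (symmetricMatrices e : Set (H →L[ℂ] H)) ⊆ schattenClass H p := by
  intro A hA
  obtain ⟨a, b, c, rfl⟩ := mem_symmetricMatrices_iff.1 hA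
  obtain ⟨f, d, hf, hfd, -⟩ := exists_ofMatrix_eq_diagonalOp he a b c
  rw [hfd]
  refine ⟨isCompactOperator_diagonalOp f d, ?_⟩
  rw [powerSum_diagonalOp hf d hp]
  exact ENNReal.ofReal_lt_top

/-- Recovering the entries yields the injectivity behind the dimension count. -/
lemma inner_ofMatrix_apply {e : Fin 2 → H} (he : Orthonormal ℂ e)
    (M : Matrix (Fin 2) (Fin 2) ℝ) (i j : Fin 2) :
    ⟪e i, ofMatrix e M (e j)⟫_ℂ = M i j := by
  simp only [ofMatrix, _root_.sum_apply, _root_.smul_apply,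
    InnerProductSpace.rankOne_apply, ← Complex.coe_smul, inner_sum, inner_smul_right,
    orthonormal_iff_ite.1 he]
  simp

/-- The real linear map sending `(a, b, c)` to the operator with matrix `!![a, b; b, c]`. -/
noncomputable def symmetricMatrixMap (e : Fin 2 → H) : (Fin 3 → ℝ) →ₗ[ℝ] (H →L[ℂ] H) where
  toFun v := ofMatrix e !![v 0, v 1; v 1, v 2]
  map_add' v w := by simp [ofMatrix, add_smul]; abel
  map_smul' c v := by simp [ofMatrix, mul_smul, smul_add]

lemma finrank_symmetricMatrices {e : Fin 2 → H} (he : Orthonormal ℂ e) :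
    Module.finrank ℝ (symmetricMatrices e) = 3 := by
  have hrange : symmetricMatrices e = LinearMap.range (symmetricMatrixMap e) := by
    ext A
    rw [mem_symmetricMatrices_iff, LinearMap.mem_range]
    constructor
    · rintro ⟨a, b, c, rfl⟩
      exact ⟨![a, b, c], rfl⟩
    · rintro ⟨v, rfl⟩
      exact ⟨v 0, v 1, v 2, rfl⟩
  have hinj : Function.Injective (symmetricMatrixMap e) := by
    intro v w h
    have hij : ∀ i j, !![v 0, v 1; v 1, v 2] i j = !![w 0, w 1; w 1, w 2] i j := fun i j => by
      have h' := congrArg (fun A : H →L[ℂ] H => ⟪e i, A (e j)⟫_ℂ) h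
      simp only [symmetricMatrixMap, LinearMap.coe_mk, AddHom.coe_mk,
        inner_ofMatrix_apply he] at h'
      exact_mod_cast h'
    ext k
    fin_cases k
    exacts [hij 0 0, hij 0 1, hij 1 1]
  rw [hrange, LinearMap.finrank_range_of_inj hinj]
  simp

/-! ### Non-embeddability -/

/-- Under a linear isometric embedding into `L_p`, `p ≠ 2`, a traceless symmetric orthogonal matrix
and the identity matrix have the same absolute value. -/
lemma ae_sq_eq_sq_of_isometry [CompleteSpace H] {α : Type*} [MeasurableSpace α] {μ : Measure α}
    {e : Fin 2 → H} (he : Orthonormal ℂ e) {p : ℝ} (hp : 0 < p) (hp2 : p ≠ 2)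
    (F : (Fin 3 → ℝ) →ₗ[ℝ] Lp ℝ (ENNReal.ofReal p) μ)
    (hF : ∀ v, ‖F v‖ = schattenNorm p (symmetricMatrixMap e v)) {s t : ℝ} (hst : s ^ 2 + t ^ 2 = 1) :
    ∀ᵐ x ∂μ, F ![s, t, -s] x ^ 2 = F ![1, 0, 1] x ^ 2 := by
  -- `P` and `Q` encode the projections onto the eigenlines of the reflection for the eigenvalues 1
  -- and -1.
  let P : Fin 3 → ℝ := ![(1 + s) / 2, t / 2, (1 - s) / 2]
  let Q : Fin 3 → ℝ := ![(1 - s) / 2, -t / 2, (1 + s) / 2]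
  have hadd : F P + F Q = F ![1, 0, 1] := by
    rw [← map_add]
    congr 1
    ext i
    fin_cases i <;> simp [P, Q] <;> ring
  have hsub : F P - F Q = F ![s, t, -s] := by
    rw [← map_sub]
    congr 1
    ext i
    fin_cases i <;> simp [P, Q] <;> ring
  have h0 : (0 : ℝ) ^ p = 0 := Real.zero_rpow hp.ne'
  have hnorm : ∀ {v : Fin 3 → ℝ} {x y : ℝ}, x + y = v 0 + v 2 → x * y = v 0 * v 2 - v 1 ^ 2 →
      ‖F v‖ ^ p = |x| ^ p + |y| ^ p := fun h1 h2 => by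
    rw [hF]; exact schattenNorm_ofMatrix_rpow he hp h1 h2
  have hP : ‖F P‖ ^ p = 1 := by
    rw [hnorm (x := 1) (y := 0) (by simp [P]; ring)
      (by simp [P]; linear_combination (1 / 4) * hst)]
    simp [h0]
  have hQ : ‖F Q‖ ^ p = 1 := by
    rw [hnorm (x := 1) (y := 0) (by simp [Q]; ring)
      (by simp [Q]; linear_combination (1 / 4) * hst)]
    simp [h0]
  have hI : ‖F ![1, 0, 1]‖ ^ p = 2 := by
    rw [hnorm (x := 1) (y := 1) (by simp) (by simp)]
    norm_num
  have hR : ‖F ![s, t, -s]‖ ^ p = 2 := by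
    rw [hnorm (x := 1) (y := -1) (by simp) (by simp; linear_combination hst)]
    norm_num
  have hdisj := ae_mul_eq_zero_of_clarkson_eq hp hp2 (F P) (F Q)
    (by rw [hadd, hsub, hP, hQ, hI, hR]; norm_num)
  rw [← hadd, ← hsub]
  filter_upwards [hdisj, Lp.coeFn_add (F P) (F Q), Lp.coeFn_sub (F P) (F Q)] with x hx h1 h2
  rw [h1, h2, Pi.add_apply, Pi.sub_apply]
  linear_combination (-4) * hx

lemma not_isometry_of_symmetricMatrixMap [CompleteSpace H] {α : Type*} [MeasurableSpace α]
    {μ : Measure α} {e : Fin 2 → H} (he : Orthonormal ℂ e) {p : ℝ} (hp : 0 < p) (hp2 : p ≠ 2)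
    (F : (Fin 3 → ℝ) →ₗ[ℝ] Lp ℝ (ENNReal.ofReal p) μ) :
    ¬ ∀ v, ‖F v‖ = schattenNorm p (symmetricMatrixMap e v) := by
  intro hF
  have h1 := ae_sq_eq_sq_of_isometry he hp hp2 F hF (s := 1) (t := 0) (by norm_num)
  have h2 := ae_sq_eq_sq_of_isometry he hp hp2 F hF (s := 0) (t := 1) (by norm_num)
  -- A rational point of the unit circle with both coordinates nonzero, so that squaring leaves a
  -- cross term.
  have h3 := ae_sq_eq_sq_of_isometry he hp hp2 F hF (s := 3 / 5) (t := 4 / 5) (by norm_num)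
  have hcomb : F ![3 / 5, 4 / 5, -(3 / 5)] =
      (3 / 5 : ℝ) • F ![1, 0, -1] + (4 / 5 : ℝ) • F ![0, 1, -0] := by
    rw [← map_smul, ← map_smul, ← map_add]
    congr 1
    ext i
    fin_cases i <;> simp
  rw [hcomb] at h3
  have hzero : F ![1, 0, 1] = 0 := by
    rw [Lp.eq_zero_iff_ae_eq_zero]
    filter_upwards [h1, h2, h3, Lp.coeFn_add ((3 / 5 : ℝ) • F ![1, 0, -1])
      ((4 / 5 : ℝ) • F ![0, 1, -0]), Lp.coeFn_smul (3 / 5 : ℝ) (F ![1, 0, -1]),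
      Lp.coeFn_smul (4 / 5 : ℝ) (F ![0, 1, -0])] with x h1 h2 h3 k1 k2 k3
    rw [k1, Pi.add_apply, k2, k3, Pi.smul_apply, Pi.smul_apply, smul_eq_mul, smul_eq_mul] at h3
    -- The pure squares already add up to `(F ![1, 0, 1] x) ^ 2`, since `9 / 25 + 16 / 25 = 1`; only
    -- the cross term, with coefficient `24 / 25`, remains.
    have hprod : F ![1, 0, -1] x * F ![0, 1, -0] x = 0 := by
      linear_combination (25 / 24) * h3 - (9 / 24) * h1 - (16 / 24) * h2
    have h4 : F ![1, 0, 1] x ^ 4 = 0 := by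
      linear_combination (F ![1, 0, -1] x * F ![0, 1, -0] x) * hprod
        - F ![0, 1, -0] x ^ 2 * h1 - F ![1, 0, 1] x ^ 2 * h2
    exact pow_eq_zero_iff (by norm_num) |>.1 h4
  have hI : schattenNorm p (symmetricMatrixMap e ![1, 0, 1]) ^ p = |1| ^ p + |1| ^ p :=
    schattenNorm_ofMatrix_rpow he hp (by simp) (by simp)
  rw [← hF, hzero, Lp.norm_zero, Real.zero_rpow hp.ne'] at hI
  norm_num at hI

lemma not_isometricToSubspaceOfLp_symmetricMatrices [CompleteSpace H] {e : Fin 2 → H}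
    (he : Orthonormal ℂ e) {p : ℝ} (hp : 0 < p) (hp2 : p ≠ 2) :
    ¬ IsometricToSubspaceOfLp p (symmetricMatrices e) := by
  rintro ⟨W, T, hT⟩
  let G : (Fin 3 → ℝ) →ₗ[ℝ] symmetricMatrices e :=
    (symmetricMatrixMap e).codRestrict _ fun v =>
      mem_symmetricMatrices_iff.2 ⟨v 0, v 1, v 2, rfl⟩
  exact not_isometry_of_symmetricMatrixMap he hp hp2 (W.subtype ∘ₗ T.toLinearMap ∘ₗ G)
    fun v => hT (G v)

lemma exists_orthonormal_pair (hH : 2 ≤ Module.rank ℂ H) : ∃ e : Fin 2 → H, Orthonormal ℂ e := by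
  obtain ⟨v, hv⟩ := Module.le_rank_iff.1 (by exact_mod_cast hH : ((2 : ℕ) : Cardinal) ≤ _)
  exact ⟨_, InnerProductSpace.gramSchmidtNormed_orthonormal hv⟩

end Schatten

theorem theorem2 {H : Type*} [NormedAddCommGroup H] [InnerProductSpace ℂ H] [CompleteSpace H]
    [TopologicalSpace.SeparableSpace H] (hH : 2 ≤ Module.rank ℂ H)
    (p : ℝ) (hp : 1 ≤ p) (hp2 : p ≠ 2) :
    (∃ V : Submodule ℝ (H →L[ℂ] H),
      (V : Set (H →L[ℂ] H)) ⊆ Schatten.schattenClass H p ∧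
      Module.finrank ℝ V = 3 ∧
      ¬ Schatten.IsometricToSubspaceOfLp p V) ∧
    (∀ e : Fin 2 → H, Orthonormal ℂ e →
      (Schatten.symmetricMatrices e : Set (H →L[ℂ] H)) ⊆ Schatten.schattenClass H p ∧
      Module.finrank ℝ (Schatten.symmetricMatrices e) = 3 ∧
      ¬ Schatten.IsometricToSubspaceOfLp p (Schatten.symmetricMatrices e)) := by
  have hp0 : 0 < p := by linarith
  have key := fun (e : Fin 2 → H) (he : Orthonormal ℂ e) =>
    And.intro (Schatten.symmetricMatrices_subset_schattenClass he hp0)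
      (And.intro (Schatten.finrank_symmetricMatrices he)
        (Schatten.not_isometricToSubspaceOfLp_symmetricMatrices he hp0 hp2))
  obtain ⟨e, he⟩ := Schatten.exists_orthonormal_pair hH
  exact ⟨⟨Schatten.symmetricMatrices e, key e he⟩, key⟩
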